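/- Let $\mathcal A$ be a $C^*$-algebra (unital or not) and let $\{\alpha_t\}_{t\in\mathbb R}$ be a strongly continuous one-parameter group of $*$-automorphisms of $\mathcal A$, that is, $\lim_{t\to0}\|\alpha_t(A)-A\|=0$ for every $A\in\mathcal A$. A state is a positive linear functional on $\mathcal A$ of norm one. For $\beta\in[0,\infty]$, a state $\varphi$ is called a $\beta$-KMS state for $\alpha$ if for all $A,B\in\mathcal A$ there is a function $F_{A,B}$ that is bounded and continuous on the closed strip $\{0\le\operatorname{Im}z\le\beta\}$ and analytic on the open strip $\{0<\operatorname{Im}z<\beta\}$, such that $$F_{A,B}(t)=\varphi(A\,\alpha_t(B))\quad\text{and, if }\beta<\infty,\quad F_{A,B}(t+i\beta)=\varphi(\alpha_t(B)A)\qquad\text{for all }t\in\mathbb R.$$ For $\beta=\infty$ the strips are the closed and the open upper half-plane, and the $\infty$-KMS states are the ground states. Let $\varphi$ be a $\beta$-KMS state for $\alpha$ with $\beta\in[0,\infty]$. If $\beta=0$, assume in addition that $\varphi$ is the only tracial state on $\mathcal A$ (for $0<\beta\le\infty$ nothing more is assumed). Then: 1. $\varphi$ is invariant under the time evolution: $\varphi(\alpha_t(A))=\varphi(A)$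 for all $A\in\mathcal A$ and $t\in\mathbb R$. 2. Let $(\mathcal H_\varphi,\pi_\varphi)$ be the GNS representation of $\varphi$, with $[A]\in\mathcal H_\varphi$ the class of $A\in\mathcal A$ (so $[A]=\pi_\varphi(A)\Omega_\varphi$ for the cyclic vector $\Omega_\varphi$). Let $U_t$ be the unitary on $\mathcal H_\varphi$ with $U_t[A]=[\alpha_t(A)]$ for all $A\in\mathcal A$, which is well defined by 1 and satisfies $U_t\pi_\varphi(A)U_t^*=\pi_\varphi(\alpha_t(A))$. Let $\mathfrak M_\varphi=\pi_\varphi(\mathcal A)''$. Then every element $Z$ of the center $\mathfrak Z_\varphi=\mathfrak M_\varphi\cap\mathfrak M_\varphi'$ is fixed by the time evolution: $U_tZU_t^*=Z$ for all $t\in\mathbb R$. Both statements hold whether or not $\varphi$ is a factor state (i.e. whether or not $\mathfrak Z_\varphi=\mathbb C I$). -/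

import Mathlib

open scoped ComplexOrder ENNReal Topology

section KMSSetup

variable {A : Type*} [NonUnitalCStarAlgebra A]

/-- A C*-dynamics: a one-parameter group `t ↦ α t` of *-automorphisms of the C*-algebra `A`
which is strongly continuous, i.e. `α t a → a` in norm as `t → 0`, for every `a`. -/
structure CStarDynamics (A : Type*) [NonUnitalCStarAlgebra A] where
  /-- The automorphism at time `t`. -/
  aut : ℝ → (A ≃⋆ₐ[ℂ] A)
  aut_zero : ∀ a, aut 0 a = a
  aut_add : ∀ s t a, aut (s + t) a = aut s (aut t a)
  strongly_continuous : ∀ a, Filter.Tendsto (fun t => aut t a) (𝓝 0) (𝓝 a)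

variable [PartialOrder A] [StarOrderedRing A]

/-- A positive linear functional on a C*-algebra as a bounded functional (boundedness is
automatic). -/
def toBounded (φ : A →ₚ[ℂ] ℂ) : A →L[ℂ] ℂ where
  toLinearMap := φ.toLinearMap
  cont := map_continuous φ

/-- A positive linear functional is a state if it is normalized, i.e. of operator norm one
(for a unital algebra this means `φ 1 = 1`). -/
def IsState (φ : A →ₚ[ℂ] ℂ) : Prop :=
  ‖toBounded φ‖ = 1

/-- A tracial functional. -/
def IsTracial (φ : A →ₚ[ℂ] ℂ) : Prop :=
  ∀ a b, φ (a * b) = φ (b * a)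

/-- The closed strip `0 ≤ Im z ≤ β`; the closed upper half-plane for `β = ∞`. -/
def closedStrip (β : ℝ≥0∞) : Set ℂ :=
  {z | 0 ≤ z.im ∧ ENNReal.ofReal z.im ≤ β}

/-- The open strip `0 < Im z < β`; the open upper half-plane for `β = ∞`. -/
def openStrip (β : ℝ≥0∞) : Set ℂ :=
  {z | 0 < z.im ∧ ENNReal.ofReal z.im < β}

/-- The KMS condition at inverse temperature `β ∈ [0, ∞]`. For every `a, b` there is a function
`F` on the closed strip, bounded and continuous there and analytic in the open strip, with
`F t = φ (a α_t(b))` and, if `β < ∞`, `F (t + iβ) = φ (α_t(b) a)` for all real `t`.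
At `β = ∞` the strip is the upper half-plane and this is the definition of ground states. -/
def IsKMS (α : CStarDynamics A) (β : ℝ≥0∞) (φ : A →ₚ[ℂ] ℂ) : Prop :=
  ∀ a b : A, ∃ F : ℂ → ℂ,
    ContinuousOn F (closedStrip β) ∧
    (∃ C : ℝ, ∀ z ∈ closedStrip β, ‖F z‖ ≤ C) ∧
    DifferentiableOn ℂ F (openStrip β) ∧
    (∀ t : ℝ, F t = φ (a * α.aut t b)) ∧
    (β ≠ ∞ → ∀ t : ℝ, F (t + β.toReal * Complex.I) = φ (α.aut t b * a))

end KMSSetup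

lemma map_symm_of_map {A : Type*} [NonUnitalCStarAlgebra A] [PartialOrder A] (φ : A →ₚ[ℂ] ℂ)
    (θ : A ≃⋆ₐ[ℂ] A) (h : ∀ a, φ (θ a) = φ a) (a : A) : φ (θ.symm a) = φ a := by
  rw [← h (θ.symm a), StarAlgEquiv.apply_symm_apply]

noncomputable section GNSSetup

variable {A : Type*} [NonUnitalCStarAlgebra A] [PartialOrder A] [StarOrderedRing A]
  (φ : A →ₚ[ℂ] ℂ)

lemma star_mem_centralizer_range_gns {x : φ.GNS →L[ℂ] φ.GNS}
    (hx : x ∈ Set.centralizer (Set.range φ.gnsNonUnitalStarAlgHom)) :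
    star x ∈ Set.centralizer (Set.range φ.gnsNonUnitalStarAlgHom) := by
  rintro _ ⟨a, rfl⟩
  have h := hx (φ.gnsNonUnitalStarAlgHom (star a)) ⟨star a, rfl⟩
  have h2 := congrArg star h
  simpa [map_star] using h2.symm

lemma coe_centralizer_centralizer_gns :
    (StarSubalgebra.centralizer ℂ (Set.centralizer (Set.range φ.gnsNonUnitalStarAlgHom)) :
      Set (φ.GNS →L[ℂ] φ.GNS)) =
    Set.centralizer (Set.centralizer (Set.range φ.gnsNonUnitalStarAlgHom)) := by
  rw [StarSubalgebra.coe_centralizer]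
  congr 1
  refine Set.union_eq_self_of_subset_right fun x hx => ?_
  have := star_mem_centralizer_range_gns φ (Set.mem_star.1 hx)
  rwa [star_star] at this

/-- The von Neumann algebra `π_φ(A)''` generated by the GNS representation of `φ`. -/
def gnsVonNeumann : VonNeumannAlgebra φ.GNS where
  toStarSubalgebra :=
    StarSubalgebra.centralizer ℂ (Set.centralizer (Set.range φ.gnsNonUnitalStarAlgHom))
  centralizer_centralizer' := by
    change Set.centralizer (Set.centralizer (StarSubalgebra.centralizer ℂ
      (Set.centralizer (Set.range φ.gnsNonUnitalStarAlgHom)) : Set (φ.GNS →L[ℂ] φ.GNS))) =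
      (StarSubalgebra.centralizer ℂ
      (Set.centralizer (Set.range φ.gnsNonUnitalStarAlgHom)) : Set (φ.GNS →L[ℂ] φ.GNS))
    rw [coe_centralizer_centralizer_gns, Set.centralizer_centralizer_centralizer]

/-- The underlying set is literally the double commutant. -/
lemma coe_gnsVonNeumann :
    (gnsVonNeumann φ : Set (φ.GNS →L[ℂ] φ.GNS)) =
      Set.centralizer (Set.centralizer (Set.range φ.gnsNonUnitalStarAlgHom)) :=
  coe_centralizer_centralizer_gns φ

/-- The center `M ∩ M'` of `M = π_φ(A)''`: the macroscopic observables of `φ`. -/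
def gnsCenter : Set (φ.GNS →L[ℂ] φ.GNS) :=
  {Z | Z ∈ gnsVonNeumann φ ∧ Z ∈ (gnsVonNeumann φ).commutant}

/-- An automorphism `θ` of `A` that preserves `φ`, as an isometry of the pre-Hilbert space `A` with
the inner product `φ (a* b)`. -/
def preGNSIsometry (θ : A ≃⋆ₐ[ℂ] A) (h : ∀ a, φ (θ a) = φ a) : φ.PreGNS →ₗᵢ[ℂ] φ.PreGNS where
  toFun x := φ.toPreGNS (θ (φ.ofPreGNS x))
  map_add' x y := by simp
  map_smul' c x := by simp
  norm_map' x := by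
    change ‖φ.toPreGNS (θ (φ.ofPreGNS x))‖ = ‖x‖
    rw [PositiveLinearMap.preGNS_norm_def, PositiveLinearMap.preGNS_norm_def]
    simp only [PositiveLinearMap.ofPreGNS_toPreGNS]
    rw [← map_star, ← map_mul, h]

/-- For a `φ`-preserving automorphism `θ`, the unitary `U` on the GNS space of `φ` given by
`U [a] = [θ a]`, i.e. `U π_φ(a) Ω_φ = π_φ(θ a) Ω_φ`. -/
def gnsUnitary (θ : A ≃⋆ₐ[ℂ] A) (h : ∀ a, φ (θ a) = φ a) : φ.GNS ≃ₗᵢ[ℂ] φ.GNS where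
  toLinearEquiv := LinearEquiv.ofLinearMap
    ((preGNSIsometry φ θ h).toContinuousLinearMap.completion : φ.GNS →ₗ[ℂ] φ.GNS)
    ((preGNSIsometry φ θ.symm (map_symm_of_map φ θ h)).toContinuousLinearMap.completion :
      φ.GNS →ₗ[ℂ] φ.GNS)
    (by
      ext x
      induction x using UniformSpace.Completion.induction_on with
      | hp => apply isClosed_eq <;> simp only [LinearMap.coe_comp, LinearMap.id_coe,
                ContinuousLinearMap.coe_coe, Function.comp_def] <;> fun_prop
      | ih x => simp [preGNSIsometry])
    (by
      ext x
      induction x using UniformSpace.Completion.induction_on with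
      | hp => apply isClosed_eq <;> simp only [LinearMap.coe_comp, LinearMap.id_coe,
                ContinuousLinearMap.coe_coe, Function.comp_def] <;> fun_prop
      | ih x => simp [preGNSIsometry])
  norm_map' x := by
    change ‖(preGNSIsometry φ θ h).toContinuousLinearMap.completion x‖ = ‖x‖
    induction x using UniformSpace.Completion.induction_on with
    | hp => apply isClosed_eq <;> fun_prop
    | ih x => simp [UniformSpace.Completion.norm_coe]

lemma gnsUnitary_coe (θ : A ≃⋆ₐ[ℂ] A) (h : ∀ a, φ (θ a) = φ a) (a : A) :
    gnsUnitary φ θ h (φ.toPreGNS a : φ.GNS) = (φ.toPreGNS (θ a) : φ.GNS) := by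
  change (preGNSIsometry φ θ h).toContinuousLinearMap.completion (φ.toPreGNS a : φ.GNS) = _
  rw [ContinuousLinearMap.completion_apply_coe]
  rfl

/-- The evolution `X ↦ U X U*` of operators on the GNS space. -/
def gnsEvolution (θ : A ≃⋆ₐ[ℂ] A) (h : ∀ a, φ (θ a) = φ a) (X : φ.GNS →L[ℂ] φ.GNS) :
    φ.GNS →L[ℂ] φ.GNS :=
  ((gnsUnitary φ θ h).toContinuousLinearEquiv : φ.GNS →L[ℂ] φ.GNS) ∘L X ∘L
    ((gnsUnitary φ θ h).symm.toContinuousLinearEquiv : φ.GNS →L[ℂ] φ.GNS)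

/-- The evolution extends `θ`: `U π_φ(a) U* = π_φ(θ a)`. -/
lemma gnsEvolution_gns (θ : A ≃⋆ₐ[ℂ] A) (h : ∀ a, φ (θ a) = φ a) (a : A) :
    gnsEvolution φ θ h (φ.gnsNonUnitalStarAlgHom a) = φ.gnsNonUnitalStarAlgHom (θ a) := by
  ext y
  obtain ⟨x, rfl⟩ := (gnsUnitary φ θ h).surjective y
  change gnsUnitary φ θ h (φ.gnsNonUnitalStarAlgHom a
    ((gnsUnitary φ θ h).symm (gnsUnitary φ θ h x))) = _
  rw [LinearIsometryEquiv.symm_apply_apply]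
  induction x using UniformSpace.Completion.induction_on with
  | hp => apply isClosed_eq <;> fun_prop
  | ih x =>
    obtain ⟨x, rfl⟩ := φ.toPreGNS.surjective x
    rw [gnsUnitary_coe]
    simp only [PositiveLinearMap.gnsNonUnitalStarAlgHom_apply_coe]
    simp [PositiveLinearMap.leftMulMapPreGNS_apply, gnsUnitary_coe]

end GNSSetup

/-! For central `Z`, the point is that the functional `a ↦ ⟪Z Ω, [a]⟫` is invariant under `α`. The
case `Z = 1` is invariance of `φ`. In general it says that the unitary `U` fixes `Z Ω`, and then `U
Z [a] = U π(a) Z Ω = π(α a) U Z Ω = Z U [a]`, so `U` commutes with `Z`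
(`gnsEvolution_eq_of_inner_invariant`).

For `β > 0` the KMS condition passes from `a ∈ A` to `Z ∈ π(A)''` (`IsKMS.isStripBoundary`): `Z Ω`
and `Z* Ω` are approximated simultaneously by `[a]` and `[a*]` (`exists_gnsClass_near`, from
Hahn–Banach and a two-fold double commutant argument), and the maximum principle carries uniform
convergence from the boundary into the strip. Centrality identifies the two boundary functions when
`β < ∞`, so the extension is periodic; when `β = ∞` it makes the conjugate of the boundary function
extend as well, so Schwarz reflection applies. Both give a bounded entire function, and Liouville
makes it constant.

For `β = 0` the state is a trace, and each `Y* Y` with `Y` central gives a positive tracial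
functional. Uniqueness makes it a multiple of `φ`, which is invariant under every automorphism;
polarization then reaches all central `Z` (`IsTracial.inner_center_invariant`). -/

/-! ### Bounded analytic functions on strips and half-planes. -/

section ComplexAnalysis

open Complex Set MeasureTheory

/-- A continuous function that is complex differentiable off a horizontal line is complex
differentiable. -/
lemma differentiableOn_of_off_horizontal_line {U : Set ℂ} (hU : IsOpen U) {f : ℂ → ℂ} (c : ℝ)
    (hf : ContinuousOn f U) (hd : ∀ z ∈ U, z.im ≠ c → DifferentiableAt ℂ f z) :
    DifferentiableOn ℂ f U := by
  refine (isConservativeOn_and_continuousOn_iff_isDifferentiableOn hU).1 ⟨?_, hf⟩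
  intro z w hzw
  rw [← add_eq_zero_iff_eq_neg, wedgeIntegral_add_wedgeIntegral_eq]
  rw [Rectangle] at hzw
  -- Cauchy's theorem on a subrectangle whose interior misses the line; a rectangle crossing it is
  -- cut at height `c`.
  have key : ∀ y₁ ∈ uIcc z.im w.im, ∀ y₂ ∈ uIcc z.im w.im, c ∉ Ioo (min y₁ y₂) (max y₁ y₂) →
      (∫ x : ℝ in z.re..w.re, f (x + y₁ * I)) - (∫ x : ℝ in z.re..w.re, f (x + y₂ * I)) +
      I • (∫ y : ℝ in y₁..y₂, f (w.re + y * I)) -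
      I • (∫ y : ℝ in y₁..y₂, f (z.re + y * I)) = 0 := by
    intro y₁ h₁ y₂ h₂ hc
    have hsub : uIcc z.re w.re ×ℂ uIcc y₁ y₂ ⊆ U := fun u hu =>
      hzw ⟨hu.1, uIcc_subset_uIcc h₁ h₂ hu.2⟩
    have := integral_boundary_rect_eq_zero_of_continuousOn_of_differentiableOn f
      ⟨z.re, y₁⟩ ⟨w.re, y₂⟩ (hf.mono hsub) (fun u hu =>
        (hd u (hsub ⟨Ioo_subset_Icc_self hu.1, Ioo_subset_Icc_self hu.2⟩) ?_).differentiableWithinAt)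
    · simpa using this
    · rintro rfl
      exact hc hu.2
  by_cases hc : c ∈ uIcc z.im w.im
  · have k₁ := key z.im left_mem_uIcc c hc (by
      rintro ⟨h, h'⟩; rcases le_total z.im c with h'' | h'' <;> simp_all)
    have k₂ := key c hc w.im right_mem_uIcc (by
      rintro ⟨h, h'⟩; rcases le_total w.im c with h'' | h'' <;> simp_all)
    have hint : ∀ x ∈ uIcc z.re w.re, ∀ y₁ ∈ uIcc z.im w.im, ∀ y₂ ∈ uIcc z.im w.im,
        IntervalIntegrable (fun y : ℝ => f (x + y * I)) volume y₁ y₂ := by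
      intro x hx y₁ h₁ y₂ h₂
      refine ContinuousOn.intervalIntegrable ?_
      refine hf.comp (by fun_prop) fun y hy => hzw ⟨?_, ?_⟩
      · simpa using hx
      · simpa using uIcc_subset_uIcc h₁ h₂ hy
    rw [← intervalIntegral.integral_add_adjacent_intervals
        (hint _ right_mem_uIcc _ left_mem_uIcc _ hc) (hint _ right_mem_uIcc _ hc _ right_mem_uIcc),
      ← intervalIntegral.integral_add_adjacent_intervals
        (hint _ left_mem_uIcc _ left_mem_uIcc _ hc) (hint _ left_mem_uIcc _ hc _ right_mem_uIcc)]
    rw [smul_add, smul_add]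
    linear_combination k₁ + k₂
  · refine key _ left_mem_uIcc _ right_mem_uIcc fun h => hc (Ioo_subset_Icc_self h)

lemma closedStrip_of_ne_top {β : ℝ≥0∞} (h : β ≠ ∞) : closedStrip β = im ⁻¹' Icc 0 β.toReal := by
  ext z
  simp [closedStrip, ENNReal.ofReal_le_iff_le_toReal h]

lemma openStrip_of_ne_top {β : ℝ≥0∞} (h : β ≠ ∞) : openStrip β = im ⁻¹' Ioo 0 β.toReal := by
  ext z
  simp only [openStrip, mem_ofPred_eq, mem_preimage, mem_Ioo]
  refine and_congr_right fun hz => ENNReal.ofReal_lt_iff_lt_toReal hz.le h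

lemma closedStrip_top : closedStrip ∞ = {z | 0 ≤ z.im} := by
  ext z; simp [closedStrip]

lemma openStrip_top : openStrip ∞ = {z | 0 < z.im} := by
  ext z; simp [openStrip]

lemma openStrip_subset_closedStrip (β : ℝ≥0∞) : openStrip β ⊆ closedStrip β :=
  fun _ hz => ⟨hz.1.le, hz.2.le⟩

lemma isClosed_closedStrip (β : ℝ≥0∞) : IsClosed (closedStrip β) := by
  by_cases h : β = ∞
  · rw [h, closedStrip_top]; exact isClosed_le continuous_const continuous_im
  · rw [closedStrip_of_ne_top h]; exact isClosed_Icc.preimage continuous_im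

lemma isOpen_openStrip (β : ℝ≥0∞) : IsOpen (openStrip β) := by
  by_cases h : β = ∞
  · rw [h, openStrip_top]; exact isOpen_lt continuous_const continuous_im
  · rw [openStrip_of_ne_top h]; exact isOpen_Ioo.preimage continuous_im

lemma ofReal_mem_closedStrip (β : ℝ≥0∞) (t : ℝ) : (t : ℂ) ∈ closedStrip β := by
  simp [closedStrip]

lemma add_mul_I_mem_closedStrip {β : ℝ≥0∞} (h : β ≠ ∞) (t : ℝ) :
    (t + β.toReal * I : ℂ) ∈ closedStrip β := by
  rw [closedStrip_of_ne_top h]; simp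

/-- The maximum principle for bounded analytic functions on a strip or half-plane. -/
lemma norm_le_of_norm_boundary_le {β : ℝ≥0∞} (hβ : β ≠ 0) {F : ℂ → ℂ}
    (hc : ContinuousOn F (closedStrip β)) (hb : ∃ C : ℝ, ∀ z ∈ closedStrip β, ‖F z‖ ≤ C)
    (hd : DifferentiableOn ℂ F (openStrip β)) {C : ℝ} (h₀ : ∀ t : ℝ, ‖F t‖ ≤ C)
    (h₁ : β ≠ ∞ → ∀ t : ℝ, ‖F (t + β.toReal * I)‖ ≤ C) {z : ℂ} (hz : z ∈ closedStrip β) :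
    ‖F z‖ ≤ C := by
  obtain ⟨M, hM⟩ := hb
  have hdc : DiffContOnCl ℂ F (openStrip β) := ⟨hd, hc.mono
    (closure_minimal (openStrip_subset_closedStrip β) (isClosed_closedStrip β))⟩
  have hM0 : 0 ≤ M := (norm_nonneg _).trans (hM z hz)
  by_cases h : β = ∞
  · subst h
    have hmem : ∀ w : ℂ, 0 ≤ w.re → I * w ∈ closedStrip ∞ := fun w hw => by
      rw [closedStrip_top]; simpa using hw
    -- The substitution `w ↦ I * w` turns the right half-plane into the upper one.
    have := PhragmenLindelof.right_half_plane_of_bounded_on_real (f := fun w => F (I * w))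
      (C := C) (z := -I * z) ?_ ?_ ?_ ?_ ?_
    · simpa [← mul_assoc] using this
    · refine hdc.comp (Differentiable.diffContOnCl (by fun_prop)) fun w hw => ?_
      rw [openStrip_top]; simpa using hw
    · refine ⟨1, by norm_num, 0, ?_⟩
      refine Asymptotics.IsBigO.of_bound M ?_
      refine Filter.mem_of_superset (Filter.mem_inf_of_right (Filter.mem_principal_self _)) ?_
      intro w hw
      simpa using hM _ (hmem w (le_of_lt hw))
    · refine ⟨M, ?_⟩
      rw [Filter.eventually_map]
      filter_upwards [Filter.eventually_ge_atTop 0] with x hx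
      exact hM _ (hmem _ (by simpa using hx))
    · intro x
      have e : I * (x * I) = ((-x : ℝ) : ℂ) := by
        push_cast
        linear_combination (x : ℂ) * I_mul_I
      rw [e]
      exact h₀ _
    · rw [closedStrip_top] at hz; simpa using hz
  · have hpos : 0 < β.toReal := ENNReal.toReal_pos hβ h
    rw [openStrip_of_ne_top h] at hdc
    rw [closedStrip_of_ne_top h] at hz hM
    refine PhragmenLindelof.horizontal_strip hdc ?_ ?_ ?_ hz.1 hz.2
    · refine ⟨0, by simpa using by positivity, 0, ?_⟩
      refine Asymptotics.IsBigO.of_bound M ?_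
      refine Filter.mem_of_superset (Filter.mem_inf_of_right (Filter.mem_principal_self _)) ?_
      intro w hw
      simpa using hM w ⟨hw.1.le, hw.2.le⟩
    · intro w hw
      have e : w = (w.re : ℂ) := by apply Complex.ext <;> simp [hw]
      rw [e]
      exact h₀ w.re
    · intro w hw
      have e : w = (w.re : ℂ) + β.toReal * I := by apply Complex.ext <;> simp [hw]
      rw [e]
      exact h₁ h w.re

/-- `f` and `g` are the lower and upper boundary values of a bounded continuous function on the
closed strip of width `β` that is analytic in its interior (for `β = ∞` there is only `f`). -/
def IsStripBoundary (β : ℝ≥0∞) (f g : ℝ → ℂ) : Prop :=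
  ∃ F : ℂ → ℂ,
    ContinuousOn F (closedStrip β) ∧
    (∃ C : ℝ, ∀ z ∈ closedStrip β, ‖F z‖ ≤ C) ∧
    DifferentiableOn ℂ F (openStrip β) ∧
    (∀ t : ℝ, F t = f t) ∧
    (β ≠ ∞ → ∀ t : ℝ, F (t + β.toReal * I) = g t)

/-- Boundary values on a strip are closed under uniform limits. -/
lemma IsStripBoundary.of_uniform_approx {β : ℝ≥0∞} (hβ : β ≠ 0) {f g : ℝ → ℂ}
    (h : ∀ ε > 0, ∃ f' g' : ℝ → ℂ, IsStripBoundary β f' g' ∧ (∀ t, ‖f' t - f t‖ ≤ ε) ∧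
      ∀ t, ‖g' t - g t‖ ≤ ε) : IsStripBoundary β f g := by
  choose! f' g' hs hf hg using h
  choose! F hc hb hd h₀ h₁ using hs
  set u : ℕ → ℝ := fun n => 1 / ((n : ℝ) + 1)
  have hu : ∀ n, 0 < u n := fun n => by positivity
  have hu0 : Filter.Tendsto u Filter.atTop (𝓝 0) := tendsto_one_div_add_atTop_nhds_zero_nat
  -- The maximum principle for differences turns uniform closeness on the boundary into uniform
  -- closeness on the strip.
  have hdist : ∀ m n, ∀ z ∈ closedStrip β, ‖F (u m) z - F (u n) z‖ ≤ u m + u n := by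
    intro m n z hz
    refine norm_le_of_norm_boundary_le hβ (F := fun z => F (u m) z - F (u n) z)
      ((hc _ (hu m)).sub (hc _ (hu n))) ?_ ((hd _ (hu m)).sub (hd _ (hu n))) ?_ ?_ hz
    · obtain ⟨C, hC⟩ := hb _ (hu m)
      obtain ⟨D, hD⟩ := hb _ (hu n)
      exact ⟨C + D, fun z hz => (norm_sub_le _ _).trans (add_le_add (hC z hz) (hD z hz))⟩
    · intro t
      simp only [h₀ _ (hu _)]
      calc ‖f' (u m) t - f' (u n) t‖ = ‖(f' (u m) t - f t) - (f' (u n) t - f t)‖ := by ring_nf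
        _ ≤ _ := (norm_sub_le _ _).trans (add_le_add (hf _ (hu m) t) (hf _ (hu n) t))
    · intro hβ' t
      simp only [h₁ _ (hu _) hβ']
      calc ‖g' (u m) t - g' (u n) t‖ = ‖(g' (u m) t - g t) - (g' (u n) t - g t)‖ := by ring_nf
        _ ≤ _ := (norm_sub_le _ _).trans (add_le_add (hg _ (hu m) t) (hg _ (hu n) t))
  have hcau : UniformCauchySeqOn (fun n => F (u n)) Filter.atTop (closedStrip β) := by
    rw [Metric.uniformCauchySeqOn_iff]
    intro ε hε
    obtain ⟨N, hN⟩ := Filter.eventually_atTop.1 (hu0.eventually (gt_mem_nhds (half_pos hε)))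
    refine ⟨N, fun m hm n hn z hz => ?_⟩
    rw [dist_eq_norm]
    linarith [hdist m n z hz, hN m hm, hN n hn]
  have hlim : ∀ z, ∃ w, z ∈ closedStrip β →
      Filter.Tendsto (fun n => F (u n) z) Filter.atTop (𝓝 w) := by
    intro z
    by_cases hz : z ∈ closedStrip β
    · obtain ⟨w, hw⟩ := cauchySeq_tendsto_of_complete (hcau.cauchySeq hz)
      exact ⟨w, fun _ => hw⟩
    · exact ⟨0, fun h => absurd h hz⟩
  choose G hG using hlim
  have hunif : TendstoUniformlyOn (fun n => F (u n)) G Filter.atTop (closedStrip β) :=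
    hcau.tendstoUniformlyOn_of_tendsto fun z hz => hG z hz
  have hpt : ∀ (v : ℝ → ℂ) (w : ℂ), (∀ ε > 0, ‖v ε - w‖ ≤ ε) →
      Filter.Tendsto (fun n => v (u n)) Filter.atTop (𝓝 w) := fun v w h => by
    rw [tendsto_iff_norm_sub_tendsto_zero]
    exact squeeze_zero (fun _ => norm_nonneg _) (fun n => h _ (hu n)) hu0
  refine ⟨G, hunif.continuousOn (Filter.Frequently.of_forall fun n => hc _ (hu n)), ?_, ?_, ?_, ?_⟩
  · obtain ⟨C, hC⟩ := hb _ (hu 0)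
    refine ⟨C + (u 0 + 1), fun z hz => ?_⟩
    refine le_of_tendsto (hG z hz).norm (Filter.Eventually.of_forall fun n => ?_)
    have h1 : u n ≤ 1 := by
      simp only [u]
      rw [div_le_one (by positivity)]
      linarith [(Nat.cast_nonneg n : (0 : ℝ) ≤ n)]
    have := hdist n 0 z hz
    have h2 := norm_sub_norm_le (F (u n) z) (F (u 0) z)
    linarith [hC z hz]
  · exact (hunif.mono (openStrip_subset_closedStrip β)).tendstoLocallyUniformlyOn.differentiableOn
      (Filter.Eventually.of_forall fun n => hd _ (hu n)) (isOpen_openStrip β)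
  · intro t
    refine tendsto_nhds_unique (hG _ (ofReal_mem_closedStrip β t)) ?_
    simp only [h₀ _ (hu _)]
    exact hpt (fun ε => f' ε t) _ fun ε hε => hf ε hε t
  · intro hβ' t
    refine tendsto_nhds_unique (hG _ (add_mul_I_mem_closedStrip hβ' t)) ?_
    simp only [h₁ _ (hu _) hβ']
    exact hpt (fun ε => g' ε t) _ fun ε hε => hg ε hε t

/-- Equal boundary values on a strip of finite width are constant. -/
lemma IsStripBoundary.eq_of_ne_top {β : ℝ≥0∞} (hβ : β ≠ 0) (hβ' : β ≠ ∞) {f : ℝ → ℂ}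
    (h : IsStripBoundary β f f) (s t : ℝ) : f s = f t := by
  obtain ⟨F, hc, ⟨C, hC⟩, hd, h₀, h₁⟩ := h
  replace h₁ := h₁ hβ'
  set b := β.toReal
  have hb : 0 < b := ENNReal.toReal_pos hβ hβ'
  rw [closedStrip_of_ne_top hβ'] at hc hC
  rw [openStrip_of_ne_top hβ'] at hd
  have hper : ∀ w : ℂ, w.im = b → F (w - b * I) = F w := by
    intro w hw
    have e₁ : w = (w.re : ℂ) + b * I := by apply Complex.ext <;> simp [hw]
    have e₂ : w - b * I = (w.re : ℂ) := by apply Complex.ext <;> simp [hw]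
    rw [e₂, h₀]
    conv_rhs => rw [e₁, h₁]
  -- Two copies of `F` glued along `Im w = b`; `hper` makes the seam continuous, and continuity
  -- there already forces analyticity.
  let H : ℂ → ℂ := fun w => if w.im ≤ b then F w else F (w - b * I)
  have hHle : ∀ w : ℂ, w.im ≤ b → H w = F w := fun w hw => if_pos hw
  have hHge : ∀ w : ℂ, b ≤ w.im → H w = F (w - b * I) := fun w hw => by
    rcases hw.eq_or_lt with h | h
    · rw [hHle w h.ge, hper w h.symm]
    · exact if_neg (not_le.2 h)
  have hHd : DifferentiableOn ℂ H (im ⁻¹' Ioo 0 (2 * b)) := by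
    refine differentiableOn_of_off_horizontal_line (isOpen_Ioo.preimage continuous_im) b ?_ ?_
    · have hu : ContinuousOn H (im ⁻¹' Icc 0 b ∪ im ⁻¹' Icc b (2 * b)) := by
        refine ContinuousOn.union_of_isClosed ?_ ?_ (isClosed_Icc.preimage continuous_im)
          (isClosed_Icc.preimage continuous_im)
        · exact hc.congr fun w hw => hHle w hw.2
        · refine ContinuousOn.congr (f := fun w => F (w - b * I)) ?_ fun w hw => hHge w hw.1
          refine hc.comp (by fun_prop) fun w hw => ?_
          simp only [mem_preimage, mem_Icc, sub_im, mul_im, ofReal_re, I_im, ofReal_im, I_re] at hw ⊢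
          constructor <;> linarith [hw.1, hw.2]
      refine hu.mono fun w hw => ?_
      rcases le_total w.im b with h | h
      · exact Or.inl ⟨hw.1.le, h⟩
      · exact Or.inr ⟨h, hw.2.le⟩
    · intro w hw hne
      rcases lt_or_gt_of_ne hne with h | h
      · have hnhds : im ⁻¹' Ioo 0 b ∈ 𝓝 w :=
          (isOpen_Ioo.preimage continuous_im).mem_nhds ⟨hw.1, h⟩
        refine (hd.differentiableAt hnhds).congr_of_eventuallyEq ?_
        filter_upwards [hnhds] with v hv using hHle v hv.2.le
      · have hnhds : im ⁻¹' Ioo b (2 * b) ∈ 𝓝 w :=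
          (isOpen_Ioo.preimage continuous_im).mem_nhds ⟨h, hw.2⟩
        have hdiff : DifferentiableAt ℂ (fun v => F (v - b * I)) w := by
          refine DifferentiableAt.comp w (f := fun v : ℂ => v - b * I) (g := F) ?_ (by fun_prop)
          refine hd.differentiableAt ((isOpen_Ioo.preimage continuous_im).mem_nhds ?_)
          have := hw.2
          simp only [mem_preimage, mem_Ioo, sub_im, mul_im, ofReal_re, I_im, ofReal_im, I_re] at this ⊢
          constructor <;> linarith
        refine hdiff.congr_of_eventuallyEq ?_
        filter_upwards [hnhds] with v hv using hHge v hv.1.le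
  -- The index with `k b < Im z ≤ (k + 1) b`. Every `z` is then interior to the double strip `(k b,
  -- (k + 2) b)`, where the periodic extension `G` is a translate of `H`.
  let k : ℂ → ℤ := fun z => ⌈z.im / b⌉ - 1
  let G : ℂ → ℂ := fun z => F (z - k z * b * I)
  have hk : ∀ (z : ℂ), k z * b < z.im ∧ z.im ≤ (k z + 1) * b := by
    intro z
    have h1 := Int.ceil_lt_add_one (z.im / b)
    have h2 := Int.le_ceil (z.im / b)
    simp only [k]; push_cast
    constructor
    · rw [← lt_div_iff₀ hb]; linarith
    · rw [← div_le_iff₀ hb]; linarith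
  have hk_uniq : ∀ (z : ℂ) (n : ℤ), n * b < z.im → z.im ≤ (n + 1) * b → k z = n := by
    intro z n h1 h2
    obtain ⟨h3, h4⟩ := hk z
    have a1 : (n : ℝ) < k z + 1 := lt_of_mul_lt_mul_right (h1.trans_le h4) hb.le
    have a2 : (k z : ℝ) < n + 1 := lt_of_mul_lt_mul_right (h3.trans_le h2) hb.le
    have a1' : n < k z + 1 := by exact_mod_cast a1
    have a2' : k z < n + 1 := by exact_mod_cast a2
    omega
  have hGH : ∀ (n : ℤ) (z : ℂ), n * b < z.im → z.im < (n + 2) * b → G z = H (z - n * b * I) := by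
    intro n z h1 h2
    rcases le_or_gt z.im ((n + 1) * b) with h | h
    · rw [hHle _ (by simp; linarith)]
      simp only [G, hk_uniq z n h1 h]
    · rw [hHge _ (by simp; linarith)]
      simp only [G, hk_uniq z (n + 1) (by push_cast; exact h) (by push_cast; linarith)]
      congr 1
      push_cast; ring
  have hGd : Differentiable ℂ G := by
    intro z
    obtain ⟨h1, h2⟩ := hk z
    have hnhds : im ⁻¹' Ioo (k z * b) ((k z + 2) * b) ∈ 𝓝 z :=
      (isOpen_Ioo.preimage continuous_im).mem_nhds ⟨h1, by linarith⟩
    have hdiff : DifferentiableAt ℂ (fun v => H (v - k z * b * I)) z := by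
      refine DifferentiableAt.comp z (f := fun v : ℂ => v - k z * b * I) (g := H) ?_ (by fun_prop)
      refine hHd.differentiableAt ((isOpen_Ioo.preimage continuous_im).mem_nhds ?_)
      constructor <;> simp <;> linarith
    refine hdiff.congr_of_eventuallyEq ?_
    filter_upwards [hnhds] with v hv using hGH _ _ hv.1 hv.2
  have hGb : Bornology.IsBounded (range G) := by
    refine isBounded_iff_forall_norm_le.2 ⟨C, ?_⟩
    rintro _ ⟨z, rfl⟩
    obtain ⟨h1, h2⟩ := hk z
    refine hC _ ?_
    constructor <;> simp <;> linarith
  have hGr : ∀ t : ℝ, G t = f t := by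
    intro t
    -- The cells are open at the bottom, so the real line is the top edge of cell `-1`, and `G`
    -- takes the upper boundary value of `F` there.
    have : k t = -1 := hk_uniq _ _ (by simpa using hb) (by simp)
    simp only [G, this]
    rw [← h₁]
    congr 1
    push_cast; ring
  rw [← hGr, ← hGr]
  exact hGd.apply_eq_apply_of_bounded hGb _ _

/-- A function on the line that, together with its conjugate, extends to the upper half-plane is
constant. -/
lemma IsStripBoundary.eq_of_top {f g g' : ℝ → ℂ} (h : IsStripBoundary ∞ f g)
    (h' : IsStripBoundary ∞ (fun t => star (f t)) g') (s t : ℝ) : f s = f t := by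
  obtain ⟨F, hc, ⟨C, hC⟩, hd, h₀, -⟩ := h
  obtain ⟨F', hc', ⟨C', hC'⟩, hd', h₀', -⟩ := h'
  rw [closedStrip_top] at hc hC hc' hC'
  rw [openStrip_top] at hd hd'
  -- Schwarz reflection, with the lower half supplied by `F'`; the halves agree on the real line
  -- because `F'` has boundary value `star f`.
  let H : ℂ → ℂ := fun w => if 0 ≤ w.im then F w else star (F' (star w))
  have hHge : ∀ w : ℂ, 0 ≤ w.im → H w = F w := fun w hw => if_pos hw
  have hHle : ∀ w : ℂ, w.im ≤ 0 → H w = star (F' (star w)) := fun w hw => by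
    rcases hw.eq_or_lt with h | h
    · have e : w = (w.re : ℂ) := by apply Complex.ext <;> simp [h]
      rw [hHge w h.ge, e]
      have : star (w.re : ℂ) = w.re := Complex.conj_ofReal _
      rw [this, h₀, h₀', star_star]
    · exact if_neg (not_le.2 h)
  have hHd : DifferentiableOn ℂ H univ := by
    refine differentiableOn_of_off_horizontal_line isOpen_univ 0 ?_ ?_
    · have hu : ContinuousOn H ({z | 0 ≤ z.im} ∪ {z | z.im ≤ 0}) := by
        refine ContinuousOn.union_of_isClosed ?_ ?_ (isClosed_le continuous_const continuous_im)
          (isClosed_le continuous_im continuous_const)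
        · exact hc.congr fun w hw => hHge w hw
        · refine ContinuousOn.congr (f := fun w => star (F' (star w))) ?_ fun w hw => hHle w hw
          refine continuous_star.comp_continuousOn (hc'.comp continuous_star.continuousOn ?_)
          intro w hw
          simpa using hw
      refine hu.mono fun w _ => ?_
      exact (le_total 0 w.im).imp id id
    · intro w _ hne
      rcases lt_or_gt_of_ne hne with h | h
      · have hnhds : {z : ℂ | z.im < 0} ∈ 𝓝 w :=
          (isOpen_lt continuous_im continuous_const).mem_nhds h
        have hdiff : DifferentiableAt ℂ (fun v => star (F' (star v))) w := by
          have : DifferentiableAt ℂ F' (star w) := hd'.differentiableAt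
            ((isOpen_lt continuous_const continuous_im).mem_nhds (by simpa using h))
          have := this.conj_conj
          simpa [Function.comp_def] using this
        refine hdiff.congr_of_eventuallyEq ?_
        filter_upwards [hnhds] with v hv using hHle v (le_of_lt hv)
      · have hnhds : {z : ℂ | 0 < z.im} ∈ 𝓝 w :=
          (isOpen_lt continuous_const continuous_im).mem_nhds h
        refine (hd.differentiableAt hnhds).congr_of_eventuallyEq ?_
        filter_upwards [hnhds] with v hv using hHge v (le_of_lt hv)
  have hHb : Bornology.IsBounded (range H) := by
    refine isBounded_iff_forall_norm_le.2 ⟨max C C', ?_⟩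
    rintro _ ⟨z, rfl⟩
    rcases le_total 0 z.im with h | h
    · rw [hHge z h]; exact (hC z h).trans (le_max_left _ _)
    · rw [hHle z h, norm_star]
      exact (hC' _ (by simpa using h)).trans (le_max_right _ _)
  have hHr : ∀ t : ℝ, H t = f t := fun t => by rw [hHge _ (by simp), h₀]
  rw [← hHr, ← hHr]
  exact (differentiableOn_univ.1 hHd).apply_eq_apply_of_bounded hHb _ _

end ComplexAnalysis

/-! ### A double commutant argument on `H ⊕ H`. -/

section Bicommutant

open scoped InnerProductSpace
open ContinuousLinearMap

variable {H : Type*} [NormedAddCommGroup H] [InnerProductSpace ℂ H]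

/-- The diagonal amplification `T ⊕ T` of an operator `T` on `H` to `H ⊕ H`. -/
noncomputable def diagL2 (T : H →L[ℂ] H) : WithLp 2 (H × H) →L[ℂ] WithLp 2 (H × H) :=
  (WithLp.prodContinuousLinearEquiv 2 ℂ H H).symm.toContinuousLinearMap ∘L (T.prodMap T) ∘L
    (WithLp.prodContinuousLinearEquiv 2 ℂ H H).toContinuousLinearMap

lemma diagL2_fst (T : H →L[ℂ] H) (x : WithLp 2 (H × H)) : (diagL2 T x).fst = T x.fst := rfl

lemma diagL2_snd (T : H →L[ℂ] H) (x : WithLp 2 (H × H)) : (diagL2 T x).snd = T x.snd := rfl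

lemma diagL2_mul (S T : H →L[ℂ] H) (x : WithLp 2 (H × H)) :
    diagL2 (S * T) x = diagL2 S (diagL2 T x) := rfl

lemma inner_diagL2_right [CompleteSpace H] (T : H →L[ℂ] H) (x y : WithLp 2 (H × H)) :
    ⟪x, diagL2 T y⟫_ℂ = ⟪diagL2 (star T) x, y⟫_ℂ := by
  rw [WithLp.prod_inner_apply, WithLp.prod_inner_apply]
  change ⟪x.fst, T y.fst⟫_ℂ + ⟪x.snd, T y.snd⟫_ℂ =
    ⟪star T x.fst, y.fst⟫_ℂ + ⟪star T x.snd, y.snd⟫_ℂ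
  simp only [star_eq_adjoint, adjoint_inner_left]

/-- The amplification of an operator of the double commutant `S''` commutes with every operator
that commutes with the amplification of `S`. -/
lemma diagL2_comm_of_mem_centralizer_centralizer {S : Set (H →L[ℂ] H)} {Z : H →L[ℂ] H}
    (hZ : Z ∈ Set.centralizer (Set.centralizer S)) {P : WithLp 2 (H × H) →L[ℂ] WithLp 2 (H × H)}
    (hP : ∀ s ∈ S, ∀ x, P (diagL2 s x) = diagL2 s (P x)) (x : WithLp 2 (H × H)) :
    P (diagL2 Z x) = diagL2 Z (P x) := by
  let e := (WithLp.prodContinuousLinearEquiv 2 ℂ H H).symm.toContinuousLinearMap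
  let q₁ := WithLp.fstL 2 ℂ H H
  let q₂ := WithLp.sndL 2 ℂ H H
  let i₁ : H →L[ℂ] WithLp 2 (H × H) := e ∘L ContinuousLinearMap.inl ℂ H H
  let i₂ : H →L[ℂ] WithLp 2 (H × H) := e ∘L ContinuousLinearMap.inr ℂ H H
  have hi₁ : ∀ (T : H →L[ℂ] H) y, i₁ (T y) = diagL2 T (i₁ y) := fun T y => by
    change WithLp.toLp 2 (T y, (0 : H)) = WithLp.toLp 2 (T y, T 0)
    rw [map_zero]
  have hi₂ : ∀ (T : H →L[ℂ] H) y, i₂ (T y) = diagL2 T (i₂ y) := fun T y => by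
    change WithLp.toLp 2 ((0 : H), T y) = WithLp.toLp 2 (T 0, T y)
    rw [map_zero]
  have hsplit : ∀ y : WithLp 2 (H × H), y = i₁ y.fst + i₂ y.snd := fun y => by
    change y = WithLp.toLp 2 (y.fst, (0 : H)) + WithLp.toLp 2 ((0 : H), y.snd)
    rw [← WithLp.toLp_add, Prod.mk_add_mk, add_zero, zero_add]
    rfl
  -- Each matrix entry of `P` commutes with `S`, hence with `Z`.
  have entry : ∀ (q : WithLp 2 (H × H) →L[ℂ] H) (i : H →L[ℂ] WithLp 2 (H × H)),
      (∀ (T : H →L[ℂ] H) y, q (diagL2 T y) = T (q y)) →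
      (∀ (T : H →L[ℂ] H) y, i (T y) = diagL2 T (i y)) →
      ∀ y, q (P (i (Z y))) = Z (q (P (i y))) := by
    intro q i hq hi y
    have hmem : q ∘L P ∘L i ∈ Set.centralizer S := by
      intro s hs
      ext y
      change s (q (P (i y))) = q (P (i (s y)))
      rw [hi, hP s hs, hq]
    exact congrArg (fun T : H →L[ℂ] H => T y) (hZ _ hmem)
  have comp : ∀ (q : WithLp 2 (H × H) →L[ℂ] H),
      (∀ (T : H →L[ℂ] H) y, q (diagL2 T y) = T (q y)) →
      q (P (diagL2 Z x)) = q (diagL2 Z (P x)) := by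
    intro q hq
    rw [hq]
    conv_lhs => rw [hsplit x, map_add, ← hi₁, ← hi₂, map_add, map_add,
      entry q i₁ hq hi₁, entry q i₂ hq hi₂]
    conv_rhs => rw [hsplit x, map_add, map_add, map_add]
  have h₁ := comp q₁ fun _ _ => rfl
  have h₂ := comp q₂ fun _ _ => rfl
  rw [hsplit (P (diagL2 Z x)), hsplit (diagL2 Z (P x))]
  exact congrArg₂ (fun a b => i₁ a + i₂ b) h₁ h₂

/-- The double commutant theorem for sums of two vector functionals: such a functional vanishes on
the double commutant of a nondegenerate self-adjoint multiplicative set of operators if it vanishes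
on the set. -/
lemma inner_add_inner_eq_zero_of_mem_centralizer_centralizer [CompleteSpace H] {S : Set (H →L[ℂ] H)}
    (hstar : ∀ s ∈ S, star s ∈ S) (hmul : ∀ s ∈ S, ∀ t ∈ S, s * t ∈ S)
    (hnd : ∀ x : H, (∀ s ∈ S, s x = 0) → x = 0)
    {Z : H →L[ℂ] H} (hZ : Z ∈ Set.centralizer (Set.centralizer S)) {v₁ v₂ w₁ w₂ : H}
    (h : ∀ s ∈ S, ⟪w₁, s v₁⟫_ℂ + ⟪w₂, s v₂⟫_ℂ = 0) :
    ⟪w₁, Z v₁⟫_ℂ + ⟪w₂, Z v₂⟫_ℂ = 0 := by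
  let v : WithLp 2 (H × H) := WithLp.toLp 2 (v₁, v₂)
  let w : WithLp 2 (H × H) := WithLp.toLp 2 (w₁, w₂)
  let N : Submodule ℂ (WithLp 2 (H × H)) := Submodule.span ℂ ((fun s => diagL2 s v) '' S)
  have hmemN : ∀ x, x ∈ Nᗮ ↔ ∀ s ∈ S, ⟪x, diagL2 s v⟫_ℂ = 0 := by
    intro x
    rw [Submodule.mem_orthogonal']
    constructor
    · exact fun hx s hs => hx _ (Submodule.subset_span ⟨s, hs, rfl⟩)
    · intro hx u hu
      induction hu using Submodule.span_induction with
      | mem u hu => obtain ⟨s, hs, rfl⟩ := hu; exact hx s hs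
      | zero => simp
      | add u u' _ _ h h' => rw [inner_add_right, h, h', add_zero]
      | smul c u _ h => rw [inner_smul_right, h, mul_zero]
  have hw : w ∈ Nᗮ := (hmemN w).2 h
  have hinv : ∀ s ∈ S, ∀ x ∈ Nᗮ, diagL2 s x ∈ Nᗮ := by
    intro s hs x hx
    rw [hmemN]
    intro t ht
    rw [← star_star s, ← inner_diagL2_right, ← diagL2_mul]
    exact (hmemN x).1 hx _ (hmul _ (hstar s hs) t ht)
  let P := Nᗮ.starProjection
  have hP : ∀ s ∈ S, ∀ x, P (diagL2 s x) = diagL2 s (P x) := by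
    intro s hs x
    refine Submodule.eq_starProjection_of_mem_orthogonal
      (hinv s hs _ (Submodule.starProjection_apply_mem _ _)) ?_
    rw [← map_sub, Submodule.mem_orthogonal]
    intro u hu
    rw [inner_diagL2_right]
    exact (Submodule.mem_orthogonal _ _).1 (Submodule.sub_starProjection_mem_orthogonal x) _
      (hinv _ (hstar s hs) u hu)
  -- As `S` need not contain the identity, `v` is not visibly in the closure of `N`. But `s (P v) =
  -- P (s v) = 0` for all `s`, and nondegeneracy applies in each component.
  have hPv : P v = 0 := by
    have h0 : ∀ s ∈ S, diagL2 s (P v) = 0 := by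
      intro s hs
      rw [← hP s hs, Submodule.starProjection_apply_eq_zero_iff]
      exact Submodule.le_orthogonal_orthogonal N (Submodule.subset_span ⟨s, hs, rfl⟩)
    have h1 : (P v).fst = 0 := hnd _ fun s hs => by rw [← diagL2_fst, h0 s hs]; rfl
    have h2 : (P v).snd = 0 := hnd _ fun s hs => by rw [← diagL2_snd, h0 s hs]; rfl
    have : P v = WithLp.toLp 2 ((P v).fst, (P v).snd) := rfl
    rw [this, h1, h2]
    rfl
  have : ⟪w, diagL2 Z v⟫_ℂ = 0 := by
    rw [← Submodule.starProjection_eq_self_iff.2 hw, Submodule.inner_starProjection_left_eq_right]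
    change ⟪w, P (diagL2 Z v)⟫_ℂ = 0
    rw [diagL2_comm_of_mem_centralizer_centralizer hZ hP, hPv, map_zero, inner_zero_right]
  exact this

end Bicommutant

/-! ### The cyclic vector and approximation in the GNS space. -/

section GNS

open scoped InnerProductSpace
open ContinuousLinearMap

variable {A : Type*} [NonUnitalCStarAlgebra A] [PartialOrder A] [StarOrderedRing A]
  (φ : A →ₚ[ℂ] ℂ)

/-- The class `[a]` of `a` in the GNS space. -/
noncomputable def gnsClass : A →ₗ[ℂ] φ.GNS :=
  (UniformSpace.Completion.toComplL : φ.PreGNS →L[ℂ] φ.GNS).toLinearMap ∘ₗ φ.toPreGNS.toLinearMap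

lemma gnsClass_eq (a : A) : gnsClass φ a = (φ.toPreGNS a : φ.GNS) := rfl

lemma inner_gnsClass (a b : A) : ⟪gnsClass φ a, gnsClass φ b⟫_ℂ = φ (star a * b) := by
  rw [gnsClass_eq, gnsClass_eq, UniformSpace.Completion.inner_coe, φ.preGNS_inner_def]
  rfl

lemma gns_apply_gnsClass (a b : A) :
    φ.gnsNonUnitalStarAlgHom a (gnsClass φ b) = gnsClass φ (a * b) := by
  rw [gnsClass_eq, φ.gnsNonUnitalStarAlgHom_apply_coe]
  rfl

lemma denseRange_gnsClass : DenseRange (gnsClass φ) :=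
  UniformSpace.Completion.denseRange_coe (α := φ.PreGNS)

variable {φ}

lemma IsState.norm_apply_le (hφ : IsState φ) (a : A) : ‖φ a‖ ≤ ‖a‖ := by
  have := (toBounded φ).le_opNorm a
  rwa [hφ, one_mul] at this

lemma IsState.norm_gnsClass_le (hφ : IsState φ) (a : A) : ‖gnsClass φ a‖ ≤ ‖a‖ := by
  refine le_of_sq_le_sq ?_ (norm_nonneg a)
  rw [← inner_self_eq_norm_sq (𝕜 := ℂ), inner_gnsClass]
  refine (RCLike.re_le_norm _).trans ((hφ.norm_apply_le _).trans ?_)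
  rw [CStarRing.norm_star_mul_self, sq]

/-- Cauchy–Schwarz bounds `φ (e * a)` for `e` in an approximate unit of norm at most one, which
replaces the missing unit; then `e * a → a`. -/
lemma IsState.norm_apply_le_norm_gnsClass (hφ : IsState φ) (a : A) :
    ‖φ a‖ ≤ ‖gnsClass φ a‖ := by
  have hu := CStarAlgebra.increasingApproximateUnit A
  have hlim := ((toBounded φ).continuous.tendsto a).comp (hu.tendsto_mul_right a)
  refine le_of_tendsto hlim.norm ?_
  filter_upwards [hu.eventually_norm] with e he
  change ‖φ (e * a)‖ ≤ _
  rw [← star_star e, ← inner_gnsClass]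
  refine (norm_inner_le_norm _ _).trans ?_
  refine mul_le_of_le_one_left (norm_nonneg _) ((hφ.norm_gnsClass_le _).trans ?_)
  rwa [norm_star]

/-- The cyclic vector of the GNS representation of a state on a C*-algebra, unital or not. -/
lemma IsState.exists_cyclic_vector (hφ : IsState φ) :
    ∃ Ω : φ.GNS, (∀ a, φ.gnsNonUnitalStarAlgHom a Ω = gnsClass φ a) ∧
      ∀ a, ⟪Ω, gnsClass φ a⟫_ℂ = φ a := by
  -- By the preceding bound `[a] ↦ φ a` extends continuously; `Ω` is its Riesz representative.
  let f : φ.GNS →L[ℂ] ℂ := φ.toLinearMap.extendOfNorm (gnsClass φ)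
  have hf : ∀ a, f (gnsClass φ a) = φ a := fun a =>
    LinearMap.extendOfNorm_eq (denseRange_gnsClass φ)
      ⟨1, fun a => by simpa using hφ.norm_apply_le_norm_gnsClass a⟩ a
  let Ω := (InnerProductSpace.toDual ℂ φ.GNS).symm f
  have hΩ : ∀ a, ⟪Ω, gnsClass φ a⟫_ℂ = φ a := fun a => by
    rw [InnerProductSpace.toDual_symm_apply, hf]
  refine ⟨Ω, fun a => ?_, hΩ⟩
  refine Dense.eq_of_inner_right (𝕜 := ℂ) (denseRange_gnsClass φ) ?_
  rintro _ ⟨b, rfl⟩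
  rw [inner_gnsClass, ← adjoint_inner_left, ← star_eq_adjoint, ← map_star, gns_apply_gnsClass,
    ← inner_conj_symm, hΩ, ← Complex.star_def, ← map_star]
  simp

lemma gns_nondegenerate {x : φ.GNS} {Ω : φ.GNS}
    (hΩ : ∀ a, φ.gnsNonUnitalStarAlgHom a Ω = gnsClass φ a)
    (hx : ∀ s ∈ Set.range φ.gnsNonUnitalStarAlgHom, s x = 0) : x = 0 := by
  refine Dense.eq_of_inner_right (𝕜 := ℂ) (denseRange_gnsClass φ) ?_
  rintro _ ⟨a, rfl⟩
  rw [← hΩ, ← adjoint_inner_right, ← star_eq_adjoint, ← map_star, hx _ ⟨_, rfl⟩]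
  simp

/-- Sums of two vector functionals that vanish on `π_φ(A)` vanish on `π_φ(A)''`. -/
lemma inner_add_inner_eq_zero_of_mem_gnsVonNeumann {Ω : φ.GNS}
    (hΩ : ∀ a, φ.gnsNonUnitalStarAlgHom a Ω = gnsClass φ a)
    {Z : φ.GNS →L[ℂ] φ.GNS} (hZ : Z ∈ gnsVonNeumann φ) {v₁ v₂ w₁ w₂ : φ.GNS}
    (h : ∀ a, ⟪w₁, φ.gnsNonUnitalStarAlgHom a v₁⟫_ℂ + ⟪w₂, φ.gnsNonUnitalStarAlgHom a v₂⟫_ℂ = 0) :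
    ⟪w₁, Z v₁⟫_ℂ + ⟪w₂, Z v₂⟫_ℂ = 0 := by
  have hZ' : Z ∈ (gnsVonNeumann φ : Set (φ.GNS →L[ℂ] φ.GNS)) := hZ
  rw [coe_gnsVonNeumann] at hZ'
  refine inner_add_inner_eq_zero_of_mem_centralizer_centralizer ?_ ?_
    (fun x hx => gns_nondegenerate hΩ hx) hZ' ?_
  · rintro _ ⟨a, rfl⟩
    exact ⟨star a, map_star _ _⟩
  · rintro _ ⟨a, rfl⟩ _ ⟨b, rfl⟩
    exact ⟨a * b, map_mul _ _ _⟩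
  · rintro _ ⟨a, rfl⟩
    exact h a

/-- Elements of `π_φ(A)''` and their adjoints are simultaneously approximated on the cyclic vector
by elements of `A` and their adjoints. -/
lemma exists_gnsClass_near {Ω : φ.GNS} (hΩ : ∀ a, φ.gnsNonUnitalStarAlgHom a Ω = gnsClass φ a)
    {Z : φ.GNS →L[ℂ] φ.GNS} (hZ : Z ∈ gnsVonNeumann φ) {ε : ℝ} (hε : 0 < ε) :
    ∃ a : A, ‖gnsClass φ a - Z Ω‖ ≤ ε ∧ ‖gnsClass φ (star a) - star Z Ω‖ ≤ ε := by
  let g : A → φ.GNS × φ.GNS := fun a => (gnsClass φ a, gnsClass φ (star a))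
  suffices hmem : (Z Ω, star Z Ω) ∈ closure (Set.range g) by
    obtain ⟨_, ⟨a, rfl⟩, ha⟩ := Metric.mem_closure_iff.1 hmem ε hε
    rw [dist_comm, dist_eq_norm, Prod.norm_def, max_lt_iff] at ha
    exact ⟨a, ha.1.le, ha.2.le⟩
  by_contra hnot
  -- Since `star` is conjugate linear, the range of `g` is only a real subspace, so only the real
  -- part of a separating functional can be controlled.
  have hsmul : ∀ (r : ℝ) a, g ((r : ℂ) • a) = (r : ℂ) • g a := fun r a => by
    simp [g, star_smul]
  have hadd : ∀ a b, g (a + b) = g a + g b := fun a b => by simp [g, star_add]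
  have hconv : Convex ℝ (Set.range g) := by
    rintro _ ⟨a, rfl⟩ _ ⟨b, rfl⟩ r s _ _ _
    refine ⟨(r : ℂ) • a + (s : ℂ) • b, ?_⟩
    rw [hadd, hsmul, hsmul, Complex.coe_smul, Complex.coe_smul]
  obtain ⟨f, u, hfu, hu⟩ := RCLike.geometric_hahn_banach_closed_point (𝕜 := ℂ)
    hconv.closure isClosed_closure hnot
  replace hfu : ∀ a, RCLike.re (f (g a)) < u := fun a => hfu _ (subset_closure ⟨a, rfl⟩)
  have hu0 : 0 < u := by
    have := hfu 0
    have hg0 : g 0 = 0 := by simp [g]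
    simpa [hg0] using this
  have hre : ∀ a, (f (g a)).re = 0 := by
    intro a
    by_contra hne
    -- This multiple of `a` has real part exactly `u`, against the strict bound.
    have := hfu (((u / (f (g a)).re : ℝ) : ℂ) • a)
    rw [hsmul, map_smul, smul_eq_mul] at this
    simp [div_mul_cancel₀ _ hne] at this
  let ξ := (InnerProductSpace.toDual ℂ φ.GNS).symm (f ∘L ContinuousLinearMap.inl ℂ _ _)
  let η := (InnerProductSpace.toDual ℂ φ.GNS).symm (f ∘L ContinuousLinearMap.inr ℂ _ _)
  have hf : ∀ x y, f (x, y) = ⟪ξ, x⟫_ℂ + ⟪η, y⟫_ℂ := by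
    intro x y
    rw [InnerProductSpace.toDual_symm_apply, InnerProductSpace.toDual_symm_apply]
    simp only [comp_apply, inl_apply, inr_apply]
    rw [← map_add, Prod.mk_add_mk, add_zero, zero_add]
  -- Under real parts the conjugate linear term in `star T` may be traded for one linear in `T`, so
  -- that the double commutant lemma applies.
  have hswap : ∀ T : φ.GNS →L[ℂ] φ.GNS, (⟪η, star T Ω⟫_ℂ).re = (⟪Ω, T η⟫_ℂ).re := fun T => by
    rw [star_eq_adjoint, adjoint_inner_right, ← inner_conj_symm, Complex.conj_re]
  let k : A → ℂ := fun a =>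
    ⟪ξ, φ.gnsNonUnitalStarAlgHom a Ω⟫_ℂ + ⟪Ω, φ.gnsNonUnitalStarAlgHom a η⟫_ℂ
  have hkre : ∀ a, (k a).re = 0 := by
    intro a
    have := hre a
    simp only [g, hf, Complex.add_re] at this
    rw [← hΩ, ← hΩ, map_star, hswap] at this
    simpa [k] using this
  have hk : ∀ a, k a = 0 := by
    intro a
    refine Complex.ext (hkre a) ?_
    have h1 : k (Complex.I • a) = Complex.I * k a := by
      simp [k, inner_smul_right, mul_add]
    have h2 := hkre (Complex.I • a)
    rw [h1] at h2
    simpa using h2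
  have hzero := inner_add_inner_eq_zero_of_mem_gnsVonNeumann hΩ hZ hk
  have : (f (Z Ω, star Z Ω)).re = 0 := by
    rw [hf, Complex.add_re, hswap, ← Complex.add_re, hzero, Complex.zero_re]
  exact absurd hu (by simpa [this] using hu0.le)

end GNS

/-! ### Central elements and the KMS condition for positive `β`. -/

section Center

open scoped InnerProductSpace
open ContinuousLinearMap

variable {A : Type*} [NonUnitalCStarAlgebra A] [PartialOrder A] [StarOrderedRing A]
  {φ : A →ₚ[ℂ] ℂ}

lemma gns_mem_gnsVonNeumann (a : A) : φ.gnsNonUnitalStarAlgHom a ∈ gnsVonNeumann φ := by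
  rw [← SetLike.mem_coe, coe_gnsVonNeumann]
  exact Set.subset_centralizer_centralizer ⟨a, rfl⟩

lemma one_mem_gnsCenter : (1 : φ.GNS →L[ℂ] φ.GNS) ∈ gnsCenter φ :=
  ⟨one_mem _, one_mem _⟩

lemma star_mem_gnsCenter {Z : φ.GNS →L[ℂ] φ.GNS} (hZ : Z ∈ gnsCenter φ) :
    star Z ∈ gnsCenter φ :=
  ⟨star_mem hZ.1, star_mem hZ.2⟩

lemma add_algebraMap_mem_gnsCenter {Z : φ.GNS →L[ℂ] φ.GNS} (hZ : Z ∈ gnsCenter φ) (c : ℂ) :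
    Z + algebraMap ℂ _ c ∈ gnsCenter φ :=
  ⟨add_mem hZ.1 ((gnsVonNeumann φ).toStarSubalgebra.algebraMap_mem c),
    add_mem hZ.2 ((gnsVonNeumann φ).commutant.toStarSubalgebra.algebraMap_mem c)⟩

lemma gns_apply_comm_of_mem_gnsCenter {Z : φ.GNS →L[ℂ] φ.GNS} (hZ : Z ∈ gnsCenter φ) (a : A)
    (x : φ.GNS) : φ.gnsNonUnitalStarAlgHom a (Z x) = Z (φ.gnsNonUnitalStarAlgHom a x) :=
  congrArg (fun T : φ.GNS →L[ℂ] φ.GNS => T x)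
    (VonNeumannAlgebra.mem_commutant_iff.1 hZ.2 _ (gns_mem_gnsVonNeumann a))

/-- Commuting `π(a)` past `Z` is what matches the two boundary functions of `IsKMS.isStripBoundary`.
-/
lemma inner_gnsClass_star_of_mem_gnsCenter {Ω : φ.GNS}
    (hΩ : ∀ a, φ.gnsNonUnitalStarAlgHom a Ω = gnsClass φ a)
    {Z : φ.GNS →L[ℂ] φ.GNS} (hZ : Z ∈ gnsCenter φ) (a : A) :
    ⟪gnsClass φ (star a), Z Ω⟫_ℂ = ⟪star Z Ω, gnsClass φ a⟫_ℂ := by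
  rw [← hΩ, map_star, star_eq_adjoint, adjoint_inner_left, gns_apply_comm_of_mem_gnsCenter hZ,
    star_eq_adjoint, adjoint_inner_left, hΩ]

lemma norm_starAlgEquiv_apply_le (θ : A ≃⋆ₐ[ℂ] A) (a : A) : ‖θ a‖ ≤ ‖a‖ :=
  NonUnitalStarAlgHom.norm_apply_le θ a

/-- The KMS condition extends from `A` to `π_φ(A)''` in the first variable. -/
lemma IsKMS.isStripBoundary (hφ : IsState φ) {α : CStarDynamics A} {β : ℝ≥0∞} (hβ : β ≠ 0)
    (hKMS : IsKMS α β φ) {Ω : φ.GNS} (hΩ : ∀ a, φ.gnsNonUnitalStarAlgHom a Ω = gnsClass φ a)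
    {Z : φ.GNS →L[ℂ] φ.GNS} (hZ : Z ∈ gnsVonNeumann φ) (b : A) :
    IsStripBoundary β (fun t => ⟪star Z Ω, gnsClass φ (α.aut t b)⟫_ℂ)
      (fun t => ⟪gnsClass φ (star (α.aut t b)), Z Ω⟫_ℂ) := by
  refine IsStripBoundary.of_uniform_approx hβ fun ε hε => ?_
  -- Since `‖[α_t b]‖ ≤ ‖b‖`, the error is at most `ε` uniformly in `t`; the `+ 1` covers `b = 0`.
  obtain ⟨a, ha, ha'⟩ := exists_gnsClass_near hΩ hZ (ε := ε / (‖b‖ + 1)) (by positivity)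
  have hb : ε / (‖b‖ + 1) * ‖b‖ ≤ ε := by
    rw [div_mul_eq_mul_div, div_le_iff₀ (by positivity)]
    nlinarith [norm_nonneg b]
  refine ⟨fun t => φ (a * α.aut t b), fun t => φ (α.aut t b * a), hKMS a b, fun t => ?_,
    fun t => ?_⟩
  · change ‖φ (a * α.aut t b) - ⟪star Z Ω, gnsClass φ (α.aut t b)⟫_ℂ‖ ≤ ε
    have e := inner_gnsClass φ (star a) (α.aut t b)
    rw [star_star] at e
    rw [← e, ← inner_sub_left]
    refine (norm_inner_le_norm _ _).trans (le_trans ?_ hb)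
    gcongr
    exact (hφ.norm_gnsClass_le _).trans (norm_starAlgEquiv_apply_le _ _)
  · change ‖φ (α.aut t b * a) - ⟪gnsClass φ (star (α.aut t b)), Z Ω⟫_ℂ‖ ≤ ε
    have e := inner_gnsClass φ (star (α.aut t b)) a
    rw [star_star] at e
    rw [← e, ← inner_sub_right]
    refine (norm_inner_le_norm _ _).trans (le_trans ?_ hb)
    rw [mul_comm]
    gcongr
    refine (hφ.norm_gnsClass_le _).trans ?_
    rw [norm_star]
    exact norm_starAlgEquiv_apply_le _ _

lemma IsKMS.inner_center_invariant (hφ : IsState φ) {α : CStarDynamics A} {β : ℝ≥0∞}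
    (hβ : β ≠ 0) (hKMS : IsKMS α β φ) {Ω : φ.GNS}
    (hΩ : ∀ a, φ.gnsNonUnitalStarAlgHom a Ω = gnsClass φ a)
    {Z : φ.GNS →L[ℂ] φ.GNS} (hZ : Z ∈ gnsCenter φ) (t : ℝ) (a : A) :
    ⟪Z Ω, gnsClass φ (α.aut t a)⟫_ℂ = ⟪Z Ω, gnsClass φ a⟫_ℂ := by
  have hZ' := star_mem_gnsCenter hZ
  have h := hKMS.isStripBoundary hφ hβ hΩ hZ'.1 a
  rw [star_star] at h
  suffices ⟪Z Ω, gnsClass φ (α.aut t a)⟫_ℂ = ⟪Z Ω, gnsClass φ (α.aut 0 a)⟫_ℂ by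
    rwa [α.aut_zero] at this
  by_cases htop : β = ∞
  · subst htop
    -- By centrality the conjugate of `⟪Z Ω, [α_t a]⟫` is `⟪star Z Ω, [α_t (star a)]⟫`, the lower
    -- boundary function for `Z` and `star a`.
    have h' := hKMS.isStripBoundary hφ hβ hΩ hZ.1 (star a)
    refine IsStripBoundary.eq_of_top h (g' := fun t => ⟪gnsClass φ (α.aut t a), Z Ω⟫_ℂ) ?_ t 0
    convert h' using 2 with t t
    · rw [Complex.star_def, inner_conj_symm, map_star (α.aut t),
        ← inner_gnsClass_star_of_mem_gnsCenter hΩ hZ, star_star]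
    · rw [map_star (α.aut t), star_star]
  · simp only [inner_gnsClass_star_of_mem_gnsCenter hΩ hZ', star_star] at h
    exact h.eq_of_ne_top hβ htop t 0

end Center

/-! ### The case `β = 0`: traces. -/

section Tracial

open scoped InnerProductSpace
open ContinuousLinearMap

variable {A : Type*} [NonUnitalCStarAlgebra A] [PartialOrder A] [StarOrderedRing A]
  {φ : A →ₚ[ℂ] ℂ}

omit [StarOrderedRing A] in
-- The strip collapses to the real line, so both boundary values at `t = 0` are `F 0`.
lemma IsKMS.isTracial {α : CStarDynamics A} (hKMS : IsKMS α 0 φ) : IsTracial φ := by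
  intro a b
  obtain ⟨F, -, -, -, h₀, h₁⟩ := hKMS a b
  have h := h₁ ENNReal.zero_ne_top 0
  have h' := h₀ 0
  simp only [α.aut_zero] at h h'
  rw [← h, ← h']
  simp

/-- Central elements give tracial functionals. -/
lemma inner_gnsClass_mul_comm_of_mem_gnsCenter (htr : IsTracial φ) {Ω : φ.GNS}
    (hΩ : ∀ a, φ.gnsNonUnitalStarAlgHom a Ω = gnsClass φ a)
    (hΩ' : ∀ a, ⟪Ω, gnsClass φ a⟫_ℂ = φ a)
    {Z : φ.GNS →L[ℂ] φ.GNS} (hZ : Z ∈ gnsCenter φ) (a b : A) :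
    ⟪Z Ω, gnsClass φ (a * b)⟫_ℂ = ⟪Z Ω, gnsClass φ (b * a)⟫_ℂ := by
  -- The functional `T ↦ ⟪[b*], T [a]⟫ - ⟪Ω, T [a b]⟫` equals `φ (b c a) - φ (c a b) = 0` at `T =
  -- π(c)`; it is evaluated at `star Z`.
  have h := inner_add_inner_eq_zero_of_mem_gnsVonNeumann hΩ (star_mem_gnsCenter hZ).1
    (w₁ := gnsClass φ (star b)) (v₁ := gnsClass φ a) (w₂ := -Ω) (v₂ := gnsClass φ (a * b)) ?_
  · rw [inner_neg_left, ← sub_eq_add_neg, sub_eq_zero, star_eq_adjoint, adjoint_inner_right,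
      adjoint_inner_right] at h
    rw [← h, ← hΩ (star b), ← gns_apply_comm_of_mem_gnsCenter hZ, map_star, star_eq_adjoint,
      adjoint_inner_left, gns_apply_gnsClass]
  · intro c
    rw [gns_apply_gnsClass, gns_apply_gnsClass, inner_neg_left, hΩ', inner_gnsClass, star_star,
      htr b, mul_assoc, add_neg_cancel]

/-- If there is only one tracial state, all positive tracial functionals are multiples of it. -/
lemma IsTracial.eq_smul_of_unique
    (hφ : ∀ ψ : A →ₚ[ℂ] ℂ, IsState ψ → IsTracial ψ → ψ = φ) {ψ : A →ₚ[ℂ] ℂ} (hψ : IsTracial ψ) :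
    ∃ c : ℂ, ∀ a, ψ a = c * φ a := by
  by_cases hN : ‖toBounded ψ‖ = 0
  · refine ⟨0, fun a => ?_⟩
    rw [norm_eq_zero] at hN
    rw [zero_mul]
    exact congrArg (fun f : A →L[ℂ] ℂ => f a) hN
  · set N := ‖toBounded ψ‖
    have hN0 : 0 ≤ N := norm_nonneg _
    let χ : A →ₚ[ℂ] ℂ := PositiveLinearMap.mk₀ (((N⁻¹ : ℝ) : ℂ) • ψ.toLinearMap) fun a ha =>
      mul_nonneg (by exact_mod_cast inv_nonneg.2 hN0) (ψ.map_nonneg ha)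
    have hχ : ∀ a, χ a = ((N⁻¹ : ℝ) : ℂ) * ψ a := fun _ => rfl
    have hstate : IsState χ := by
      have : toBounded χ = ((N⁻¹ : ℝ) : ℂ) • toBounded ψ := rfl
      rw [IsState, this, norm_smul, Complex.norm_real, Real.norm_of_nonneg (inv_nonneg.2 hN0)]
      exact inv_mul_cancel₀ hN
    have := hφ χ hstate fun a b => by rw [hχ, hχ, hψ a b]
    refine ⟨N, fun a => ?_⟩
    rw [← this, hχ, ← mul_assoc, ← Complex.ofReal_mul, mul_inv_cancel₀ hN]
    simp

/-- A unique tracial state is invariant under automorphisms. -/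
lemma IsTracial.map_eq_of_unique (hstate : IsState φ) (htr : IsTracial φ)
    (hφ : ∀ ψ : A →ₚ[ℂ] ℂ, IsState ψ → IsTracial ψ → ψ = φ) (θ : A ≃⋆ₐ[ℂ] A) (a : A) :
    φ (θ a) = φ a := by
  let f : A →ₗ[ℂ] ℂ :=
    { toFun := fun a => φ (θ a)
      map_add' := fun x y => by rw [map_add, map_add]
      map_smul' := fun c x => by rw [map_smul, map_smul]; rfl }
  let χ : A →ₚ[ℂ] ℂ := PositiveLinearMap.mk₀ f fun x hx => by
    obtain ⟨y, rfl⟩ := CStarAlgebra.nonneg_iff_eq_star_mul_self.1 hx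
    refine φ.map_nonneg ?_
    rw [map_mul, map_star]
    exact star_mul_self_nonneg _
  have hχ : ∀ x, χ x = φ (θ x) := fun _ => rfl
  have hχstate : IsState χ := by
    refine le_antisymm (opNorm_le_bound _ zero_le_one fun x => ?_) ?_
    · rw [one_mul]
      exact (hstate.norm_apply_le _).trans (norm_starAlgEquiv_apply_le θ x)
    · rw [← show ‖toBounded φ‖ = 1 from hstate]
      refine opNorm_le_bound _ (norm_nonneg _) fun x => ?_
      have h := (toBounded χ).le_opNorm (θ.symm x)
      have e : toBounded χ (θ.symm x) = toBounded φ x := by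
        change φ (θ (θ.symm x)) = φ x
        rw [StarAlgEquiv.apply_symm_apply]
      rw [e] at h
      refine h.trans ?_
      gcongr
      exact norm_starAlgEquiv_apply_le θ.symm x
  exact congrArg (fun ψ : A →ₚ[ℂ] ℂ => ψ a)
    (hφ χ hχstate fun x y => by rw [hχ, hχ, map_mul θ, map_mul θ, htr])

lemma IsTracial.inner_center_invariant (hstate : IsState φ) (htr : IsTracial φ)
    (hφ : ∀ ψ : A →ₚ[ℂ] ℂ, IsState ψ → IsTracial ψ → ψ = φ) {Ω : φ.GNS}
    (hΩ : ∀ a, φ.gnsNonUnitalStarAlgHom a Ω = gnsClass φ a)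
    (hΩ' : ∀ a, ⟪Ω, gnsClass φ a⟫_ℂ = φ a)
    {Z : φ.GNS →L[ℂ] φ.GNS} (hZ : Z ∈ gnsCenter φ) (θ : A ≃⋆ₐ[ℂ] A) (a : A) :
    ⟪Z Ω, gnsClass φ (θ a)⟫_ℂ = ⟪Z Ω, gnsClass φ a⟫_ℂ := by
  have hpos : ∀ Y ∈ gnsCenter φ,
      ⟪star Y (Y Ω), gnsClass φ (θ a)⟫_ℂ = ⟪star Y (Y Ω), gnsClass φ a⟫_ℂ := by
    intro Y hY
    have hYY : star Y * Y ∈ gnsCenter φ :=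
      ⟨mul_mem (star_mem hY.1) hY.1, mul_mem (star_mem hY.2) hY.2⟩
    let ψ : A →ₚ[ℂ] ℂ := PositiveLinearMap.mk₀
      ((innerSL ℂ (star Y (Y Ω))).toLinearMap ∘ₗ gnsClass φ) fun x hx => by
        obtain ⟨c, rfl⟩ := CStarAlgebra.nonneg_iff_eq_star_mul_self.1 hx
        change 0 ≤ ⟪(star Y * Y) Ω, gnsClass φ (star c * c)⟫_ℂ
        rw [← gns_apply_gnsClass, map_star, star_eq_adjoint (φ.gnsNonUnitalStarAlgHom c),
          adjoint_inner_right, gns_apply_comm_of_mem_gnsCenter hYY, hΩ]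
        change 0 ≤ ⟪star Y (Y (gnsClass φ c)), gnsClass φ c⟫_ℂ
        rw [star_eq_adjoint, adjoint_inner_left, inner_self_eq_norm_sq_to_K]
        positivity
    have hψ : ∀ x, ψ x = ⟪(star Y * Y) Ω, gnsClass φ x⟫_ℂ := fun _ => rfl
    obtain ⟨c, hc⟩ := IsTracial.eq_smul_of_unique hφ (ψ := ψ) fun x y => by
      rw [hψ, hψ, inner_gnsClass_mul_comm_of_mem_gnsCenter htr hΩ hΩ' hYY]
    change ψ (θ a) = ψ a
    rw [hc, hc, htr.map_eq_of_unique hstate hφ]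
  rw [← sub_eq_zero, ← inner_sub_right]
  set x := gnsClass φ (θ a) - gnsClass φ a
  -- Polarization: `hpos` for `Y = Z + c`, to be used with `c = ±1, ±I` to isolate the term in `Z
  -- Ω`.
  have hpol : ∀ c : ℂ, ⟪star Z (Z Ω), x⟫_ℂ + star c * ⟪star Z Ω, x⟫_ℂ + c * ⟪Z Ω, x⟫_ℂ +
      c * star c * ⟪Ω, x⟫_ℂ = 0 := by
    intro c
    have h := hpos _ (add_algebraMap_mem_gnsCenter hZ c)
    rw [← sub_eq_zero, ← inner_sub_right] at h
    have e : star (Z + algebraMap ℂ _ c) ((Z + algebraMap ℂ (φ.GNS →L[ℂ] φ.GNS) c) Ω) =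
        star Z (Z Ω) + c • star Z Ω + star c • Z Ω + (c * star c) • Ω := by
      rw [Algebra.algebraMap_eq_smul_one, star_add, star_smul, star_one]
      simp only [add_apply, smul_apply, one_apply_eq_self, map_add, map_smul, smul_add, smul_smul]
      abel
    rw [e] at h
    simp only [inner_add_left, inner_smul_left, map_mul, ← Complex.star_def, star_star] at h
    linear_combination h
  have h1 := hpol 1
  have h2 := hpol (-1)
  have h3 := hpol Complex.I
  have h4 := hpol (-Complex.I)
  simp only [Complex.star_def, map_neg, map_one, Complex.conj_I] at h1 h2 h3 h4
  have h5 : 4 * ⟪Z Ω, x⟫_ℂ = 0 := by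
    linear_combination h1 - h2 - Complex.I * (h3 - h4) +
      (2 * ⟪Z Ω, x⟫_ℂ - 2 * ⟪star Z Ω, x⟫_ℂ) * Complex.I_mul_I
  simpa using h5

end Tracial

/-! ### From invariant vector functionals to fixed operators. -/

section Evolution

open scoped InnerProductSpace
open ContinuousLinearMap

variable {A : Type*} [NonUnitalCStarAlgebra A] [PartialOrder A] [StarOrderedRing A]
  {φ : A →ₚ[ℂ] ℂ}

/-- A central element is fixed by the evolution if its vector functional is invariant. -/
lemma gnsEvolution_eq_of_inner_invariant {Ω : φ.GNS}
    (hΩ : ∀ a, φ.gnsNonUnitalStarAlgHom a Ω = gnsClass φ a)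
    {Z : φ.GNS →L[ℂ] φ.GNS} (hZ : Z ∈ gnsCenter φ) (θ : A ≃⋆ₐ[ℂ] A) (h : ∀ a, φ (θ a) = φ a)
    (hinv : ∀ a, ⟪Z Ω, gnsClass φ (θ a)⟫_ℂ = ⟪Z Ω, gnsClass φ a⟫_ℂ) :
    gnsEvolution φ θ h Z = Z := by
  have hU : ∀ a, gnsUnitary φ θ h (gnsClass φ a) = gnsClass φ (θ a) := gnsUnitary_coe φ θ h
  -- Against `[θ b] = U [b]`, unitarity gives `⟪Z Ω, [b]⟫`, which equals `⟪Z Ω, [θ b]⟫` by `hinv`.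
  have hfix : gnsUnitary φ θ h (Z Ω) = Z Ω := by
    refine Dense.eq_of_inner_left (𝕜 := ℂ) (denseRange_gnsClass φ) ?_
    rintro _ ⟨a, rfl⟩
    obtain ⟨b, rfl⟩ : ∃ b, θ b = a := ⟨θ.symm a, θ.apply_symm_apply a⟩
    rw [← hU, LinearIsometryEquiv.inner_map_map, hU, hinv]
  have hcomm : ∀ x, gnsUnitary φ θ h (Z x) = Z (gnsUnitary φ θ h x) := by
    intro x
    refine (denseRange_gnsClass φ).induction_on x ?_ fun a => ?_
    · exact isClosed_eq (by fun_prop) (by fun_prop)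
    · rw [hU, ← hΩ, ← hΩ, ← gns_apply_comm_of_mem_gnsCenter hZ, ← gns_apply_comm_of_mem_gnsCenter hZ]
      have e := congrArg (fun T : φ.GNS →L[ℂ] φ.GNS => T (gnsUnitary φ θ h (Z Ω)))
        (gnsEvolution_gns φ θ h a)
      change gnsUnitary φ θ h (φ.gnsNonUnitalStarAlgHom a
        ((gnsUnitary φ θ h).symm (gnsUnitary φ θ h (Z Ω)))) = _ at e
      rw [LinearIsometryEquiv.symm_apply_apply] at e
      rw [e, hfix]
  ext x
  change gnsUnitary φ θ h (Z ((gnsUnitary φ θ h).symm x)) = Z x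
  rw [hcomm, LinearIsometryEquiv.apply_symm_apply]

end Evolution

theorem mainTheorem2 {A : Type*} [NonUnitalCStarAlgebra A] [PartialOrder A] [StarOrderedRing A]
    (α : CStarDynamics A) (β : ℝ≥0∞) (φ : A →ₚ[ℂ] ℂ) (hφ : IsState φ) (hKMS : IsKMS α β φ)
    (hzero : β = 0 → ∀ ψ : A →ₚ[ℂ] ℂ, IsState ψ → IsTracial ψ → ψ = φ) :
    ∃ hinv : ∀ (t : ℝ) (a : A), φ (α.aut t a) = φ a,
      ∀ Z ∈ gnsCenter φ, ∀ t : ℝ, gnsEvolution φ (α.aut t) (hinv t) Z = Z := by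
  obtain ⟨Ω, hΩ, hΩ'⟩ := hφ.exists_cyclic_vector
  have key : ∀ Z ∈ gnsCenter φ, ∀ (t : ℝ) (a : A),
      inner ℂ (Z Ω) (gnsClass φ (α.aut t a)) = inner ℂ (Z Ω) (gnsClass φ a) := by
    intro Z hZ t a
    by_cases hβ : β = 0
    · subst hβ
      exact hKMS.isTracial.inner_center_invariant hφ (hzero rfl) hΩ hΩ' hZ (α.aut t) a
    · exact hKMS.inner_center_invariant hφ hβ hΩ hZ t a
  refine ⟨fun t a => ?_, fun Z hZ t => gnsEvolution_eq_of_inner_invariant hΩ hZ _ _ (key Z hZ t)⟩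
  -- For `Z = 1` the vector functional is `φ` itself.
  have h := key 1 one_mem_gnsCenter t a
  change inner ℂ Ω _ = inner ℂ Ω _ at h
  rwa [hΩ', hΩ'] at h
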